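/- Let $G$ and $H$ be real (smooth) Lie groups with Lie algebras $\mathfrak g=T_{e_G}G$ and $\mathfrak h=T_{e_H}H$, and let $\Phi:G\to\mathrm{Aut}(H)$ be a smooth action of $G$ on $H$ by automorphisms, i.e. a group homomorphism such that $(g,h)\mapsto\Phi(g)h$ is smooth. For $g\in G$ let $\Phi(g)_{*e_H}:\mathfrak h\to\mathfrak h$ be the differential of $\Phi(g)$ at $e_H$, and let $\phi:\mathfrak g\to\mathfrak{gl}(\mathfrak h)$ be the differential at $e_G$ of $g\mapsto \Phi(g)_{*e_H}$. Let $\mathcal B:H\to G$ be a relative Rota-Baxter operator, i.e. a smooth map with $$\mathcal B(h_1)\,\mathcal B(h_2)=\mathcal B\big(h_1\cdot\Phi(\mathcal B(h_1))h_2\big)\qquad(h_1,h_2\in H),$$ and put $B=\mathcal B_{*e_H}:\mathfrak h\to\mathfrak g$. The descendent Lie group $(H,\star)$ of $\mathcal B$ is the manifold $H$ with the product $h_1\star h_2=h_1\cdot\Phi(\mathcal B(h_1))h_2$; its unit is $e_H$, and the inverse of $h$ is $h^\dagger=\Phi(\mathcal B(h)^{-1})h^{-1}$. It acts on the manifold $G$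 by $$\Theta(h)g=\mathcal B(\Phi(g)h^\dagger)^{-1}\cdot g\cdot\mathcal B(h^\dagger),\qquad \Theta(h)e_G=e_G .$$ Then $\phi$ is a Lie algebra homomorphism $\mathfrak g\to\mathrm{Der}(\mathfrak h)$, and $B$ is a relative Rota-Baxter operator of weight $1$ with respect to $\phi$, i.e. $[B(u),B(v)]_{\mathfrak g}=B\big(\phi(B(u))v-\phi(B(v))u+[u,v]_{\mathfrak h}\big)$ for all $u,v\in\mathfrak h$. Moreover: 1. The Lie algebra $(\mathfrak h,[\cdot,\cdot]_\star)$ of the descendent Lie group $(H,\star)$ is the descendent Lie algebra $(\mathfrak h,[\cdot,\cdot]_B)$ of $B$; that is, for all $u,v\in\mathfrak h$, $$[u,v]_\star=[u,v]_B:=\phi(B(u))v-\phi(B(v))u+[u,v]_{\mathfrak h}.$$ 2. The map $h\mapsto\Theta(h)_{*e_G}$ is a smooth linear action of $(H,\star)$ on the vector space $\mathfrak g$, and its differential at $e_H$ is the representation $\theta$ of the descendent Lie algebra $(\mathfrak h,[\cdot,\cdot]_B)$ on $\mathfrak g$ given by $$\theta(u)x=B(\phi(x)u)+[B(u),x]_{\mathfrak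 g}\qquad(u\in\mathfrak h,\ x\in\mathfrak g).$$ -/

import Mathlib

open scoped Manifold ContDiff

noncomputable section

/-! ### Relative Rota-Baxter operators of weight one on Lie algebras -/

section LieAlgebraLevel

attribute [local instance] LieRing.ofAssociativeRing

variable {R g h : Type*} [CommRing R] [LieRing g] [LieAlgebra R g] [LieRing h] [LieAlgebra R h]

/-- A relative Rota-Baxter operator (of weight `1`) on the Lie algebra `g` with respect to an
action `φ` of `g` on the Lie algebra `h` by derivations. -/
structure LieRelRotaBaxter (φ : g →ₗ⁅R⁆ LieDerivation R h h) where
  /-- the underlying linear map -/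
  toLin : h →ₗ[R] g
  bracket_eq : ∀ u v : h,
    ⁅toLin u, toLin v⁆ = toLin (φ (toLin u) v - φ (toLin v) u + ⁅u, v⁆)

namespace LieRelRotaBaxter

variable {φ : g →ₗ⁅R⁆ LieDerivation R h h}

/-- The vector space underlying the descendent Lie algebra: a copy of `h`. -/
def Descendent (_B : LieRelRotaBaxter φ) : Type _ := h

variable (B : LieRelRotaBaxter φ)

instance : AddCommGroup B.Descendent := inferInstanceAs (AddCommGroup h)
instance : Module R B.Descendent := inferInstanceAs (Module R h)

/-- The identity map from `h` to the descendent Lie algebra. -/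
def toDescendent : h ≃ₗ[R] B.Descendent := LinearEquiv.refl R h

/-- The descendent bracket `[u, v]_B = φ(B u) v - φ(B v) u + [u, v]`. -/
def descBracket (u v : h) : h := φ (B.toLin u) v - φ (B.toLin v) u + ⁅u, v⁆

lemma toLin_descBracket (u v : h) : B.toLin (B.descBracket u v) = ⁅B.toLin u, B.toLin v⁆ :=
  (B.bracket_eq u v).symm

lemma action_lie (x y : g) (u : h) : φ ⁅x, y⁆ u = φ x (φ y u) - φ y (φ x u) := by
  rw [LieHom.map_lie, LieDerivation.commutator_apply]

/-- The descendent Lie algebra of `B`. -/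
instance : LieRing B.Descendent where
  bracket u v := B.toDescendent (B.descBracket (B.toDescendent.symm u) (B.toDescendent.symm v))
  add_lie (u v w : h) := by
    change B.descBracket (u + v) w = B.descBracket u w + B.descBracket v w
    simp only [descBracket, map_add, LieDerivation.add_apply, add_lie]
    abel
  lie_add (u v w : h) := by
    change B.descBracket u (v + w) = B.descBracket u v + B.descBracket u w
    simp only [descBracket, map_add, LieDerivation.add_apply, lie_add]
    abel
  lie_self (u : h) := by
    change B.descBracket u u = 0
    simp [descBracket]
  leibniz_lie (u v w : h) := by
    change B.descBracket u (B.descBracket v w) =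
      B.descBracket (B.descBracket u v) w + B.descBracket v (B.descBracket u w)
    have key (a b : h) : B.descBracket a b = φ (B.toLin a) b - φ (B.toLin b) a + ⁅a, b⁆ := rfl
    rw [key u (B.descBracket v w), key (B.descBracket u v) w, key v (B.descBracket u w),
      toLin_descBracket, toLin_descBracket, toLin_descBracket, action_lie, action_lie, action_lie]
    simp only [descBracket, map_add, map_sub, add_lie, sub_lie, lie_add, lie_sub,
      LieDerivation.apply_lie_eq_add]
    rw [leibniz_lie u v w, ← lie_skew v (φ (B.toLin w) u)]
    abel

instance : LieAlgebra R B.Descendent where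
  lie_smul t (u v : h) := by
    change B.descBracket u (t • v) = t • B.descBracket u v
    simp only [descBracket, map_smul, LieDerivation.smul_apply, lie_smul, smul_add, smul_sub]

/-- The operator `θ(u) : x ↦ B(φ(x) u) + [B u, x]` on `g`. -/
def thetaEnd (u : h) : Module.End R g where
  toFun x := B.toLin (φ x u) + ⁅B.toLin u, x⁆
  map_add' x y := by
    simp only [map_add, LieDerivation.add_apply, lie_add]; abel
  map_smul' t x := by
    simp only [map_smul, LieDerivation.smul_apply, lie_smul, smul_add, RingHom.id_apply]

/-- The representation `θ` of the descendent Lie algebra on the vector space `g`. -/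
def theta : B.Descendent →ₗ⁅R⁆ Module.End R g where
  toFun u := B.thetaEnd (B.toDescendent.symm u)
  map_add' (u v : h) := by
    ext x
    change B.toLin (φ x (u + v)) + ⁅B.toLin (u + v), x⁆ =
      (B.toLin (φ x u) + ⁅B.toLin u, x⁆) + (B.toLin (φ x v) + ⁅B.toLin v, x⁆)
    simp only [map_add, add_lie]; abel
  map_smul' t (u : h) := by
    ext x
    change B.toLin (φ x (t • u)) + ⁅B.toLin (t • u), x⁆ =
      t • (B.toLin (φ x u) + ⁅B.toLin u, x⁆)
    simp only [map_smul, smul_lie, smul_add]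
  map_lie' := by
    intro (u : h) (v : h)
    ext x
    change B.toLin (φ x (B.descBracket u v)) + ⁅B.toLin (B.descBracket u v), x⁆ =
      (B.toLin (φ (B.toLin (φ x v) + ⁅B.toLin v, x⁆) u)
        + ⁅B.toLin u, B.toLin (φ x v) + ⁅B.toLin v, x⁆⁆)
      - (B.toLin (φ (B.toLin (φ x u) + ⁅B.toLin u, x⁆) v)
        + ⁅B.toLin v, B.toLin (φ x u) + ⁅B.toLin u, x⁆⁆)
    rw [toLin_descBracket, lie_add, lie_add, B.bracket_eq u (φ x v), B.bracket_eq v (φ x u), lie_lie]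
    simp only [descBracket, map_add, map_sub, LieDerivation.add_apply, action_lie,
      LieDerivation.apply_lie_eq_add]
    rw [← lie_skew v (φ x u), map_neg]
    abel

end LieRelRotaBaxter

end LieAlgebraLevel

/-! ### Relative Rota-Baxter operators on Lie groups -/

section LieGroupLevel

/-- A real smooth Lie group is in particular regular enough for its tangent space at the identity
to be a Lie algebra. -/
instance instLEInftyMinSmoothnessThree : ENat.LEInfty (minSmoothness ℝ 3) :=
  ⟨by rw [minSmoothness_of_isRCLikeNormedField]; exact ENat.LEInfty.out⟩

variable {EG MG EH MH : Type*}
  [NormedAddCommGroup EG] [NormedSpace ℝ EG] [TopologicalSpace MG]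
  [NormedAddCommGroup EH] [NormedSpace ℝ EH] [TopologicalSpace MH]
  (IG : ModelWithCorners ℝ EG MG) (IH : ModelWithCorners ℝ EH MH)
  (G H : Type*)
  [TopologicalSpace G] [ChartedSpace MG G] [Group G]
  [TopologicalSpace H] [ChartedSpace MH H] [Group H]

/-- A smooth action `Φ : G → Aut(H)` of the Lie group `G` on the Lie group `H`. -/
structure LieGroupAction where
  /-- the underlying homomorphism to the group of automorphisms of `H` -/
  toHom : G →* MulAut H
  contMDiff_action : ContMDiff (IG.prod IH) IH ∞ (fun p : G × H => toHom p.1 p.2)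

variable {IG IH G H}

namespace LieGroupAction

variable (Φ : LieGroupAction IG IH G H)

/-- The differential `Φ(g)_{*e_H}` of `Φ(g) : H → H` at the identity, where the tangent space at
`Φ(g) e_H = e_H` is the model space `EH` of `H`, as for all tangent spaces of `H`. -/
def tangentAction (g : G) : EH →L[ℝ] EH := mfderiv IH IH (fun k : H => Φ.toHom g k) 1

/-- The differential at `e_G` of the map `g ↦ Φ(g)_{*e_H}`. -/
def diffActionL : EG →L[ℝ] EH →L[ℝ] EH :=
  mfderiv IG 𝓘(ℝ, EH →L[ℝ] EH) Φ.tangentAction (1 : G)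

/-- The differentiated action `φ : 𝔤 → 𝔤𝔩(𝔥)` of `Φ`, in the form `(x, u) ↦ φ(x) u`. -/
def diffAction (x : GroupLieAlgebra IG G) (u : GroupLieAlgebra IH H) : GroupLieAlgebra IH H :=
  Φ.diffActionL x u

end LieGroupAction

/-- A relative Rota-Baxter operator `𝓑 : H → G` on the Lie group `G` with respect to `(H, Φ)`. -/
structure RelRotaBaxter (Φ : LieGroupAction IG IH G H) where
  /-- the underlying map -/
  toFun : H → G
  contMDiff_toFun : ContMDiff IH IG ∞ toFun
  mul_eq : ∀ h₁ h₂ : H, toFun h₁ * toFun h₂ = toFun (h₁ * Φ.toHom (toFun h₁) h₂)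

namespace RelRotaBaxter

variable {Φ : LieGroupAction IG IH G H}

/-- The manifold underlying the descendent Lie group `(H, ⋆)`: a copy of `H`. -/
def DescGroup (_B : RelRotaBaxter Φ) : Type _ := H

variable (B : RelRotaBaxter Φ)

instance : TopologicalSpace B.DescGroup := inferInstanceAs (TopologicalSpace H)
instance : ChartedSpace MH B.DescGroup := inferInstanceAs (ChartedSpace MH H)

/-- The differential `Diff(𝓑) = 𝓑_{*e_H} : 𝔥 → 𝔤`, where `𝓑(e_H) = e_G`. -/
def diff : GroupLieAlgebra IH H →L[ℝ] GroupLieAlgebra IG G :=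
  mfderiv IH IG B.toFun (1 : H)

/-- The descendent multiplication `h₁ ⋆ h₂ = h₁ · Φ(𝓑(h₁)) h₂`. -/
def star (h₁ h₂ : H) : H := h₁ * Φ.toHom (B.toFun h₁) h₂

/-- The descendent inverse `h† = Φ(𝓑(h)⁻¹) h⁻¹`. -/
def dagger (k : H) : H := Φ.toHom (B.toFun k)⁻¹ k⁻¹

lemma map_one : B.toFun 1 = 1 := by
  have := B.mul_eq 1 1
  simpa using this

/-- The group structure `⋆` of the descendent Lie group. -/
instance : Group B.DescGroup where
  mul h₁ h₂ := B.star h₁ h₂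
  one := (1 : H)
  inv k := B.dagger k
  mul_assoc (a b c : H) := by
    change B.star (B.star a b) c = B.star a (B.star b c)
    unfold star
    rw [← B.mul_eq, _root_.map_mul Φ.toHom, MulAut.mul_apply, _root_.map_mul, mul_assoc]
  one_mul (a : H) := by
    change B.star 1 a = a
    simp [star, B.map_one]
  mul_one (a : H) := by
    change B.star a 1 = a
    simp [star]
  inv_mul_cancel (a : H) := by
    change B.star (B.dagger a) a = 1
    have hB : B.toFun (B.dagger a) = (B.toFun a)⁻¹ := by
      have h1 := B.mul_eq a (B.dagger a)
      have h2 : a * Φ.toHom (B.toFun a) (B.dagger a) = 1 := by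
        rw [dagger, ← MulAut.mul_apply, ← _root_.map_mul]
        simp
      rw [h2, B.map_one] at h1
      exact (inv_eq_of_mul_eq_one_right h1).symm
    rw [star, hB, dagger, ← _root_.map_mul]
    simp

/-- The descendent group is a Lie group. -/
instance [LieGroup IG ∞ G] [LieGroup IH ∞ H] : LieGroup IH ∞ B.DescGroup where
  toIsManifold := inferInstanceAs (IsManifold IH ∞ H)
  contMDiff_mul := by
    have h1 : ContMDiff (IH.prod IH) (IG.prod IH) ∞ (fun p : H × H => (B.toFun p.1, p.2)) :=
      (B.contMDiff_toFun.comp contMDiff_fst).prodMk contMDiff_snd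
    have h2 : ContMDiff (IH.prod IH) IH ∞ (fun p : H × H => Φ.toHom (B.toFun p.1) p.2) :=
      Φ.contMDiff_action.comp h1
    have h3 : ContMDiff (IH.prod IH) IH ∞ (fun p : H × H => B.star p.1 p.2) :=
      contMDiff_fst.mul h2
    exact h3
  contMDiff_inv := by
    have h1 : ContMDiff IH (IG.prod IH) ∞ (fun k : H => ((B.toFun k)⁻¹, k⁻¹)) :=
      B.contMDiff_toFun.inv.prodMk contMDiff_id.inv
    have h2 : ContMDiff IH IH ∞ (fun k : H => B.dagger k) := Φ.contMDiff_action.comp h1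
    exact h2

/-- The identity map from `𝔥 = T_e H` to the tangent space at the identity of the descendent
Lie group, which is the same manifold with the same identity element. -/
def tangentId : GroupLieAlgebra IH H ≃ₗ[ℝ] GroupLieAlgebra IH B.DescGroup :=
  LinearEquiv.refl ℝ EH

/-- The action `Θ(h) g = 𝓑(Φ(g) h†)⁻¹ · g · 𝓑(h†)` of the descendent Lie group on `G`. -/
def Theta (k : B.DescGroup) (a : G) : G :=
  (B.toFun (Φ.toHom a (k⁻¹ : B.DescGroup)))⁻¹ * a * B.toFun (k⁻¹ : B.DescGroup)

/-- The induced linear action `Θ(h)_{*e_G}` on `𝔤`, where `Θ(h) e_G = e_G`; all tangent spaces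
of `G` are the model space `EG`. -/
def tangentTheta (k : B.DescGroup) : EG →L[ℝ] EG := mfderiv IG IG (B.Theta k) (1 : G)

/-- The differential at the identity of the descendent Lie group of `h ↦ Θ(h)_{*e_G}`. -/
def diffThetaL : EH →L[ℝ] EG →L[ℝ] EG :=
  mfderiv IH 𝓘(ℝ, EG →L[ℝ] EG) B.tangentTheta (1 : B.DescGroup)

/-- The differential `Θ_{*e_H} : 𝔥 → 𝔤𝔩(𝔤)` of `Θ : (H, ⋆) → GL(𝔤)`, in the form
`(u, x) ↦ Θ_{*e_H}(u) x`. -/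
def diffTheta (u : GroupLieAlgebra IH B.DescGroup) (x : GroupLieAlgebra IG G) :
    GroupLieAlgebra IG G :=
  B.diffThetaL u x

lemma Theta_one (k : B.DescGroup) : B.Theta k 1 = 1 := by
  change (B.toFun (Φ.toHom 1 (B.dagger k)))⁻¹ * 1 * B.toFun (B.dagger k) = 1
  simp

end RelRotaBaxter

end LieGroupLevel

end

/-! Each Lie algebra identity is a group identity differentiated twice at the unit: in an inner
variable, which gives an identity between operators on the model spaces, then in an outer variable
by the product rule. No flows or exponentials enter. The link with the bracket of left-invariant
fields is that it is the derivative of `Ad` (`adjointDeriv_apply`).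

On the group level, 𝓑 is a homomorphism (H, ⋆) → G, so its differential preserves brackets; with [u,
v]_⋆ computed, this is the weight 1 identity. For the bracket, ⋆-conjugation splits into two factors
(`star_conj`): h · Φ(𝓑 h)k · h⁻¹ contributes [u, v] + φ(B u)v, and h · Φ(𝓑 h 𝓑 k (𝓑 h)⁻¹)h⁻¹
contributes -φ(B v)u. Likewise Θ(h)g is the product of 𝓑(Φ(g)h†)⁻¹ 𝓑(h†) and 𝓑(h) g 𝓑(h)⁻¹
(`Theta_eq`), which contribute B(φ(x)u) and [B u, x].

The new terms come from h · Φ(g)h⁻¹ and 𝓑(Φ(g)h)⁻¹ 𝓑(h), which are trivial as soon as g or h is. At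
such a point the mixed second derivative is intrinsic and symmetric (`modelDeriv_modelDeriv_symm`),
so the variable h may be differentiated first, where only the chain rule is needed. -/

noncomputable section

/-! ### Derivatives on model spaces and symmetry of mixed derivatives -/

section ModelDerivative

open Filter Topology Set

variable {E F E' M N P HM HN HP EM EN EP : Type*}
  [NormedAddCommGroup E] [NormedSpace ℝ E] [NormedAddCommGroup F] [NormedSpace ℝ F]
  [NormedAddCommGroup E'] [NormedSpace ℝ E']
  [NormedAddCommGroup EM] [NormedSpace ℝ EM] [TopologicalSpace HM]
  [NormedAddCommGroup EN] [NormedSpace ℝ EN] [TopologicalSpace HN]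
  [NormedAddCommGroup EP] [NormedSpace ℝ EP] [TopologicalSpace HP]
  [TopologicalSpace M] [ChartedSpace HM M] [TopologicalSpace N] [ChartedSpace HN N]
  [TopologicalSpace P] [ChartedSpace HP P]
  (IM : ModelWithCorners ℝ EM HM) (IN : ModelWithCorners ℝ EN HN) (IP : ModelWithCorners ℝ EP HP)

/-- The derivative of a map between manifolds, as a map between the model vector spaces. -/
def modelDeriv (f : M → N) (x : M) : EM →L[ℝ] EN := mfderiv IM IN f x

variable {IM IN IP}

/-- The base point of `g` enters through an equation, so points that agree only propositionally,
such as `g * 1 * g⁻¹` and `1`, need no transport between tangent spaces. -/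
theorem modelDeriv_comp {g : N → P} {f : M → N} {x : M} {y : N} (h : f x = y)
    (hg : MDifferentiableAt IN IP g y) (hf : MDifferentiableAt IM IN f x) :
    modelDeriv IM IP (fun z => g (f z)) x = (modelDeriv IN IP g y).comp (modelDeriv IM IN f x) := by
  subst h
  exact mfderiv_comp x hg hf

theorem modelDeriv_const (x : M) (y : N) : modelDeriv IM IN (fun _ : M => y) x = 0 :=
  mfderiv_const

theorem modelDeriv_id (x : M) : modelDeriv IM IM (fun z : M => z) x = ContinuousLinearMap.id ℝ EM :=
  mfderiv_id

theorem modelDeriv_extChartAt_self [IsManifold IM 1 M] (x : M) :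
    modelDeriv IM 𝓘(ℝ, EM) (extChartAt IM x) x = ContinuousLinearMap.id ℝ EM :=
  mfderiv_extChartAt_self

/-- Without boundary the model has full range, so the derivative within the range that defines
`mfderiv` is an ordinary one. -/
theorem hasFDerivAt_modelDeriv [IM.Boundaryless] {f : M → E'} {x : M}
    (hf : MDifferentiableAt IM 𝓘(ℝ, E') f x) :
    HasFDerivAt (fun z => f ((extChartAt IM x).symm z)) (modelDeriv IM 𝓘(ℝ, E') f x)
      (extChartAt IM x x) := by
  have h := hf.hasMFDerivAt.2
  rw [IM.range_eq_univ] at h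
  exact hasFDerivWithinAt_univ.1 h

theorem modelDeriv_eq_fderiv [IM.Boundaryless] {f : M → E'} {x : M}
    (hf : MDifferentiableAt IM 𝓘(ℝ, E') f x) :
    modelDeriv IM 𝓘(ℝ, E') f x =
      fderiv ℝ (fun z => f ((extChartAt IM x).symm z)) (extChartAt IM x x) :=
  (hasFDerivAt_modelDeriv hf).fderiv.symm

/-- Mixed partial derivatives of a function of two vector variables commute. -/
theorem fderiv_fderiv_symm {f : E → F → E'} {a : E} {b : F}
    (hf : ContDiffAt ℝ ∞ (fun p : E × F => f p.1 p.2) (a, b)) (u : E) (v : F) :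
    fderiv ℝ (fun x => fderiv ℝ (fun y => f x y) b) a u v =
      fderiv ℝ (fun y => fderiv ℝ (fun x => f x y) a) b v u := by
  set g : E × F → E' := fun p => f p.1 p.2 with hg
  have hd : ∀ᶠ p in 𝓝 (a, b), DifferentiableAt ℝ g p := by
    have := (hf.of_le (m := 1) (by simp)).eventually (by simp)
    exact this.mono fun p hp => hp.differentiableAt one_ne_zero
  have h2 : DifferentiableAt ℝ (fderiv ℝ g) (a, b) :=
    (hf.fderiv_right (m := 1) (by rw [one_add_one_eq_two]; exact ENat.LEInfty.out)).differentiableAt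
      one_ne_zero
  have c1 : ContinuousAt (fun x : E => (x, b)) a := by fun_prop
  have c2 : ContinuousAt (fun y : F => (a, y)) b := by fun_prop
  -- Near the point, each partial derivative is the total derivative of `g` restricted to one
  -- factor, so both sides become values of the second derivative of `g`.
  have e1 : (fun x => fderiv ℝ (fun y => f x y) b) =ᶠ[𝓝 a]
      fun x => (fderiv ℝ g (x, b)).comp (ContinuousLinearMap.inr ℝ E F) := by
    filter_upwards [c1.eventually hd] with x hx
    exact (hx.hasFDerivAt.comp b (hasFDerivAt_prodMk_right (𝕜 := ℝ) x b)).fderiv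
  have e2 : (fun y => fderiv ℝ (fun x => f x y) a) =ᶠ[𝓝 b]
      fun y => (fderiv ℝ g (a, y)).comp (ContinuousLinearMap.inl ℝ E F) := by
    filter_upwards [c2.eventually hd] with y hy
    exact (hy.hasFDerivAt.comp a (hasFDerivAt_prodMk_left (𝕜 := ℝ) a y)).fderiv
  rw [e1.fderiv_eq, e2.fderiv_eq]
  have d1 := (h2.hasFDerivAt.comp a (hasFDerivAt_prodMk_left (𝕜 := ℝ) a b)).clm_comp
    (hasFDerivAt_const (ContinuousLinearMap.inr ℝ E F) a)
  have d2 := (h2.hasFDerivAt.comp b (hasFDerivAt_prodMk_right (𝕜 := ℝ) a b)).clm_comp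
    (hasFDerivAt_const (ContinuousLinearMap.inl ℝ E F) b)
  have s := (hf.isSymmSndFDerivAt
    (by rw [minSmoothness_of_isRCLikeNormedField]; exact ENat.LEInfty.out)).eq (u, 0) (0, v)
  have d1' := congrArg (fun L => L u v) d1.fderiv
  have d2' := congrArg (fun L => L v u) d2.fderiv
  simp only [Function.comp_def] at d1' d2'
  rw [d1', d2']
  simpa using s

/-- In general the derivative is smooth only in tangent coordinates. Here the base point `b` is
fixed and the target is a vector space, so both coordinate changes are the identity. -/
theorem contMDiffAt_modelDeriv_of_vector [IsManifold IN 1 N] [IsManifold IM 1 M]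
    {f : M → N → E'} {a : M} {b : N}
    (hf : ContMDiffAt (IM.prod IN) 𝓘(ℝ, E') ∞ (fun p : M × N => f p.1 p.2) (a, b)) :
    ContMDiffAt IM 𝓘(ℝ, EN →L[ℝ] E') ∞ (fun x => modelDeriv IN 𝓘(ℝ, E') (f x) b) a := by
  have h := ContMDiffAt.mfderiv (m := ∞) (n := ∞) (x₀ := a) f (fun _ => b) hf contMDiffAt_const
    (by simp)
  have key : inTangentCoordinates IN 𝓘(ℝ, E') (fun _ => b) (fun x => f x b)
      (fun x => modelDeriv IN 𝓘(ℝ, E') (f x) b) a =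
      fun x => modelDeriv IN 𝓘(ℝ, E') (f x) b := by
    funext x
    refine (inTangentCoordinates_eq (I := IN) (I' := 𝓘(ℝ, E')) (fun _ => b) (fun x => f x b)
      (fun x => modelDeriv IN 𝓘(ℝ, E') (f x) b) (mem_chart_source _ _) (mem_univ _)).trans ?_
    have h1 : (tangentBundleCore IN N).coordChange (achart HN b) (achart HN b) b =
        ContinuousLinearMap.id ℝ EN := by
      ext v
      exact (tangentBundleCore IN N).coordChange_self (achart HN b) b (mem_chart_source _ _) v
    have h2 : (tangentBundleCore 𝓘(ℝ, E') E').coordChange (achart E' (f x b)) (achart E' (f a b))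
        (f x b) = ContinuousLinearMap.id ℝ E' :=
      tangentBundleCore_coordChange_model_space _ _ _
    rw [h1, h2]
    rfl
  exact key ▸ h

/-- Read in the charts at `a` and `b`, both sides are iterated Fréchet derivatives of one function
on `EM × EN`. -/
theorem modelDeriv_modelDeriv_symm_of_vector [IM.Boundaryless] [IN.Boundaryless]
    [IsManifold IM ∞ M] [IsManifold IN ∞ N] {f : M → N → E'} {a : M} {b : N}
    (hf : ContMDiffAt (IM.prod IN) 𝓘(ℝ, E') ∞ (fun p : M × N => f p.1 p.2) (a, b))
    (u : EM) (v : EN) :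
    modelDeriv IM 𝓘(ℝ, EN →L[ℝ] E') (fun x => modelDeriv IN 𝓘(ℝ, E') (f x) b) a u v =
      modelDeriv IN 𝓘(ℝ, EM →L[ℝ] E')
        (fun y => modelDeriv IM 𝓘(ℝ, E') (fun x => f x y) a) b v u := by
  have : IsManifold IM 1 M := IsManifold.of_le (n := ∞) (by simp)
  have : IsManifold IN 1 N := IsManifold.of_le (n := ∞) (by simp)
  have hf' : ContMDiffAt (IN.prod IM) 𝓘(ℝ, E') ∞ (fun p : N × M => f p.2 p.1) (b, a) :=
    ContMDiffAt.comp (b, a) (g := fun p : M × N => f p.1 p.2) (f := fun p : N × M => (p.2, p.1))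
      hf (contMDiffAt_snd.prodMk contMDiffAt_fst)
  have s1 := contMDiffAt_modelDeriv_of_vector hf
  have s2 := contMDiffAt_modelDeriv_of_vector (f := fun y x => f x y) hf'
  rw [modelDeriv_eq_fderiv (s1.mdifferentiableAt (by simp)),
    modelDeriv_eq_fderiv (s2.mdifferentiableAt (by simp))]
  have ha : (extChartAt IM a).target ∈ 𝓝 (extChartAt IM a a) := extChartAt_target_mem_nhds a
  have hb : (extChartAt IN b).target ∈ 𝓝 (extChartAt IN b b) := extChartAt_target_mem_nhds b
  have sa : ContMDiffAt 𝓘(ℝ, EM) IM ∞ (extChartAt IM a).symm (extChartAt IM a a) :=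
    (contMDiffOn_extChartAt_symm a).contMDiffAt ha
  have sb : ContMDiffAt 𝓘(ℝ, EN) IN ∞ (extChartAt IN b).symm (extChartAt IN b b) :=
    (contMDiffOn_extChartAt_symm b).contMDiffAt hb
  have hd : ∀ᶠ p in 𝓝 (a, b), MDifferentiableAt (IM.prod IN) 𝓘(ℝ, E')
      (fun p : M × N => f p.1 p.2) p := by
    have := (contMDiffAt_iff_contMDiffAt_nhds (by simp)).1 (hf.of_le (m := 1) (by simp))
    exact this.mono fun p hp => hp.mdifferentiableAt one_ne_zero
  have e1 : (fun z => modelDeriv IN 𝓘(ℝ, E') (f ((extChartAt IM a).symm z)) b)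
      =ᶠ[𝓝 (extChartAt IM a a)] fun z => fderiv ℝ
        (fun w => f ((extChartAt IM a).symm z) ((extChartAt IN b).symm w)) (extChartAt IN b b) := by
    have c : Tendsto (fun z => ((extChartAt IM a).symm z, b)) (𝓝 (extChartAt IM a a))
        (𝓝 (a, b)) := by
      have := sa.continuousAt.prodMk (continuousAt_const (y := b))
      rw [ContinuousAt, extChartAt_to_inv] at this
      exact this
    filter_upwards [c.eventually hd] with z hz
    exact modelDeriv_eq_fderiv (f := f ((extChartAt IM a).symm z))
      (hz.comp (f := fun y => ((extChartAt IM a).symm z, y)) b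
        (mdifferentiableAt_const.prodMk mdifferentiableAt_id))
  have e2 : (fun w => modelDeriv IM 𝓘(ℝ, E') (fun x => f x ((extChartAt IN b).symm w)) a)
      =ᶠ[𝓝 (extChartAt IN b b)] fun w => fderiv ℝ
        (fun z => f ((extChartAt IM a).symm z) ((extChartAt IN b).symm w)) (extChartAt IM a a) := by
    have c : Tendsto (fun w => (a, (extChartAt IN b).symm w)) (𝓝 (extChartAt IN b b))
        (𝓝 (a, b)) := by
      have := (continuousAt_const (y := a)).prodMk sb.continuousAt
      rw [ContinuousAt, extChartAt_to_inv] at this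
      exact this
    filter_upwards [c.eventually hd] with w hw
    exact modelDeriv_eq_fderiv (f := fun x => f x ((extChartAt IN b).symm w))
      (hw.comp (f := fun x => (x, (extChartAt IN b).symm w)) a
        (mdifferentiableAt_id.prodMk mdifferentiableAt_const))
  rw [e1.fderiv_eq, e2.fderiv_eq]
  apply fderiv_fderiv_symm (f := fun z w => f ((extChartAt IM a).symm z) ((extChartAt IN b).symm w))
  have h : ContMDiffAt (𝓘(ℝ, EM).prod 𝓘(ℝ, EN)) 𝓘(ℝ, E') ∞
      (fun p : EM × EN => f ((extChartAt IM a).symm p.1) ((extChartAt IN b).symm p.2))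
      (extChartAt IM a a, extChartAt IN b b) := by
    refine ContMDiffAt.comp_of_eq (g := fun p : M × N => f p.1 p.2)
      (f := fun p : EM × EN => ((extChartAt IM a).symm p.1, (extChartAt IN b).symm p.2))
      hf ?_ (by simp)
    exact (sa.comp (extChartAt IM a a, extChartAt IN b b) contMDiffAt_fst).prodMk
      (sb.comp (extChartAt IM a a, extChartAt IN b b) contMDiffAt_snd)
  rw [← modelWithCornersSelf_prod, chartedSpaceSelf_prod] at h
  exact h.contDiffAt

/-- Reading a map in the chart at the image point does not change its derivative. -/
theorem modelDeriv_extChartAt_comp [IsManifold IP 1 P] {f : N → P} {b : N} {p : P} (h : f b = p)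
    (hf : MDifferentiableAt IN IP f b) :
    modelDeriv IN 𝓘(ℝ, EP) (fun y => extChartAt IP p (f y)) b = modelDeriv IN IP f b := by
  rw [modelDeriv_comp (g := extChartAt IP p) h
    (mdifferentiableAt_extChartAt (mem_chart_source _ _)) hf, modelDeriv_extChartAt_self,
    ContinuousLinearMap.id_comp]

variable {f : M → N → P} {a : M} {b : N} {p : P}

theorem ContMDiff.mdifferentiableAt_right
    (hf : ContMDiff (IM.prod IN) IP ∞ (fun q : M × N => f q.1 q.2)) (x : M) (y : N) :
    MDifferentiableAt IN IP (f x) y :=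
  (hf.comp (f := fun y => (x, y)) (contMDiff_const.prodMk contMDiff_id)).mdifferentiableAt
    (by simp)

theorem ContMDiff.swap_uncurry
    (hf : ContMDiff (IM.prod IN) IP ∞ (fun q : M × N => f q.1 q.2)) :
    ContMDiff (IN.prod IM) IP ∞ (fun q : N × M => f q.2 q.1) :=
  hf.comp (f := fun q : N × M => (q.2, q.1)) (contMDiff_snd.prodMk contMDiff_fst)

/-- The derivative in the second variable, at a point where the map does not depend on the first
variable, is a smooth function of the first variable. -/
theorem contMDiff_modelDeriv [IsManifold IM ∞ M] [IsManifold IN ∞ N] [IsManifold IP ∞ P]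
    (hf : ContMDiff (IM.prod IN) IP ∞ (fun q : M × N => f q.1 q.2)) (hb : ∀ x, f x b = p) :
    ContMDiff IM 𝓘(ℝ, EN →L[ℝ] EP) ∞ (fun x => modelDeriv IN IP (f x) b) := by
  have : IsManifold IM 1 M := IsManifold.of_le (n := ∞) (by simp)
  have : IsManifold IN 1 N := IsManifold.of_le (n := ∞) (by simp)
  have : IsManifold IP 1 P := IsManifold.of_le (n := ∞) (by simp)
  intro a
  -- As `f x b = p` for every `x`, the one chart at `p`, whose derivative there is the identity,
  -- serves all inner derivatives and reduces the claim to a vector-valued map.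
  simp_rw [← fun x => modelDeriv_extChartAt_comp (hb x) (hf.mdifferentiableAt_right x b)]
  apply contMDiffAt_modelDeriv_of_vector (f := fun x y => extChartAt IP p (f x y))
  exact ContMDiffAt.comp_of_eq (y := p) (contMDiffAt_extChartAt) (hf (a, b)) (hb a)

/-- Mixed derivatives commute at a point where the map is constant in each variable. -/
theorem modelDeriv_modelDeriv_symm [IM.Boundaryless] [IN.Boundaryless]
    [IsManifold IM ∞ M] [IsManifold IN ∞ N] [IsManifold IP ∞ P]
    (hf : ContMDiff (IM.prod IN) IP ∞ (fun q : M × N => f q.1 q.2))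
    (hb : ∀ x, f x b = p) (ha : ∀ y, f a y = p) (u : EM) (v : EN) :
    modelDeriv IM 𝓘(ℝ, EN →L[ℝ] EP) (fun x => modelDeriv IN IP (f x) b) a u v =
      modelDeriv IN 𝓘(ℝ, EM →L[ℝ] EP) (fun y => modelDeriv IM IP (fun x => f x y) a) b v u := by
  have : IsManifold IP 1 P := IsManifold.of_le (n := ∞) (by simp)
  simp_rw [← fun x => modelDeriv_extChartAt_comp (hb x) (hf.mdifferentiableAt_right x b),
    ← fun y => modelDeriv_extChartAt_comp (f := fun x => f x y) (ha y)
      (hf.swap_uncurry.mdifferentiableAt_right (f := fun y x => f x y) y a)]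
  apply modelDeriv_modelDeriv_symm_of_vector (f := fun x y => extChartAt IP p (f x y))
  exact ContMDiffAt.comp_of_eq (y := p) (contMDiffAt_extChartAt) (hf (a, b)) (hb a)

variable {E₁ E₂ E₃ : Type*}
  [NormedAddCommGroup E₁] [NormedSpace ℝ E₁] [NormedAddCommGroup E₂] [NormedSpace ℝ E₂]
  [NormedAddCommGroup E₃] [NormedSpace ℝ E₃]

theorem modelDeriv_clm_comp [IM.Boundaryless] {g : M → E₂ →L[ℝ] E₃} {f : M → E₁ →L[ℝ] E₂} {a : M}
    (hg : MDifferentiableAt IM 𝓘(ℝ, E₂ →L[ℝ] E₃) g a)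
    (hf : MDifferentiableAt IM 𝓘(ℝ, E₁ →L[ℝ] E₂) f a) (u : EM) (v : E₁) :
    modelDeriv IM 𝓘(ℝ, E₁ →L[ℝ] E₃) (fun x => (g x).comp (f x)) a u v =
      modelDeriv IM 𝓘(ℝ, E₂ →L[ℝ] E₃) g a u (f a v) +
        g a (modelDeriv IM 𝓘(ℝ, E₁ →L[ℝ] E₂) f a u v) := by
  have h := (hasFDerivAt_modelDeriv hg).clm_comp (hasFDerivAt_modelDeriv hf)
  rw [modelDeriv_eq_fderiv (hg.clm_comp hf), h.fderiv]
  simp [add_comm]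

theorem modelDeriv_add {f g : M → E'} {a : M}
    (hf : MDifferentiableAt IM 𝓘(ℝ, E') f a) (hg : MDifferentiableAt IM 𝓘(ℝ, E') g a) :
    modelDeriv IM 𝓘(ℝ, E') (fun x => f x + g x) a =
      modelDeriv IM 𝓘(ℝ, E') f a + modelDeriv IM 𝓘(ℝ, E') g a :=
  (hf.hasMFDerivAt.add hg.hasMFDerivAt).mfderiv

theorem modelDeriv_sub {f g : M → E'} {a : M}
    (hf : MDifferentiableAt IM 𝓘(ℝ, E') f a) (hg : MDifferentiableAt IM 𝓘(ℝ, E') g a) :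
    modelDeriv IM 𝓘(ℝ, E') (fun x => f x - g x) a =
      modelDeriv IM 𝓘(ℝ, E') f a - modelDeriv IM 𝓘(ℝ, E') g a :=
  (hf.hasMFDerivAt.sub hg.hasMFDerivAt).mfderiv

theorem modelDeriv_clm [IM.Boundaryless] (L : E₁ →L[ℝ] E₂) {f : M → E₁} {a : M}
    (hf : MDifferentiableAt IM 𝓘(ℝ, E₁) f a) (u : EM) :
    modelDeriv IM 𝓘(ℝ, E₂) (fun x => L (f x)) a u = L (modelDeriv IM 𝓘(ℝ, E₁) f a u) := by
  rw [modelDeriv_comp (g := L) rfl L.mdifferentiableAt hf]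
  have : modelDeriv 𝓘(ℝ, E₁) 𝓘(ℝ, E₂) L (f a) = L := L.hasMFDerivAt.mfderiv
  rw [this]
  rfl

end ModelDerivative

/-! ### The adjoint action and the Lie bracket -/

section Adjoint

open Filter Topology Set VectorField

variable {EG MG EN MN : Type*}
  [NormedAddCommGroup EG] [NormedSpace ℝ EG] [TopologicalSpace MG]
  [NormedAddCommGroup EN] [NormedSpace ℝ EN] [TopologicalSpace MN]
  {IG : ModelWithCorners ℝ EG MG} {IN : ModelWithCorners ℝ EN MN}
  {G N : Type*} [TopologicalSpace G] [ChartedSpace MG G] [Group G]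
  [TopologicalSpace N] [ChartedSpace MN N]

variable (IG) in
/-- The adjoint action of a Lie group on its tangent space at the identity. -/
def adjointAction (g : G) : EG →L[ℝ] EG := modelDeriv IG IG (fun k : G => g * k * g⁻¹) 1

theorem adjointAction_one : adjointAction IG (1 : G) = ContinuousLinearMap.id ℝ EG := by
  simp only [adjointAction, one_mul, inv_one, mul_one]
  exact modelDeriv_id 1

variable (IG G) in
/-- The Lie bracket of a Lie group as a continuous bilinear map on the model space. -/
def adjointDeriv : EG →L[ℝ] EG →L[ℝ] EG :=
  modelDeriv IG 𝓘(ℝ, EG →L[ℝ] EG) (adjointAction IG : G → EG →L[ℝ] EG) 1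

variable [LieGroup IG ∞ G]

/-- Multiplication has differential `(u, v) ↦ u + v` at `(1, 1)`, because `z * 1` and `1 * z` are
both the identity map. -/
theorem modelDeriv_mul {f g : N → G} {b : N} (hf : MDifferentiableAt IN IG f b)
    (hg : MDifferentiableAt IN IG g b) (hf1 : f b = 1) (hg1 : g b = 1) :
    modelDeriv IN IG (fun y => f y * g y) b = modelDeriv IN IG f b + modelDeriv IN IG g b := by
  have hm : MDifferentiableAt (IG.prod IG) IG (fun p : G × G => p.1 * p.2) ((1 : G), (1 : G)) :=
    (contMDiff_mul IG ∞).mdifferentiableAt (by simp)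
  rw [modelDeriv_comp (g := fun p : G × G => p.1 * p.2) (f := fun y => (f y, g y))
    (y := (1, 1)) (by rw [hf1, hg1]) hm (hf.prodMk hg)]
  ext v
  have h := mfderiv_prod_eq_add_apply (v := (modelDeriv IN IG f b v, modelDeriv IN IG g b v)) hm
  have hp : modelDeriv IN (IG.prod IG) (fun y => (f y, g y)) b =
      (modelDeriv IN IG f b).prod (modelDeriv IN IG g b) :=
    (hf.hasMFDerivAt.prodMk hg.hasMFDerivAt).mfderiv
  have e1 : modelDeriv IG IG (fun z : G => z * 1) 1 = ContinuousLinearMap.id ℝ EG := by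
    simp_rw [mul_one]; exact modelDeriv_id 1
  have e2 : modelDeriv IG IG (fun z : G => 1 * z) 1 = ContinuousLinearMap.id ℝ EG := by
    simp_rw [one_mul]; exact modelDeriv_id 1
  rw [hp]
  refine h.trans ?_
  change modelDeriv IG IG (fun z : G => z * 1) 1 (modelDeriv IN IG f b v) +
    modelDeriv IG IG (fun z : G => 1 * z) 1 (modelDeriv IN IG g b v) = _
  rw [e1, e2]
  rfl

theorem modelDeriv_inv {f : N → G} {b : N} (hf : MDifferentiableAt IN IG f b) (hf1 : f b = 1) :
    modelDeriv IN IG (fun y => (f y)⁻¹) b = - modelDeriv IN IG f b := by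
  have hi : MDifferentiableAt IN IG (fun y => (f y)⁻¹) b :=
    ((contMDiff_inv IG ∞).mdifferentiableAt (by simp)).comp b hf
  have h := modelDeriv_mul hi hf (by rw [hf1, inv_one]) hf1
  simp_rw [inv_mul_cancel] at h
  rw [modelDeriv_const] at h
  exact eq_neg_of_add_eq_zero_left h.symm

theorem contMDiff_conj :
    ContMDiff (IG.prod IG) IG ∞ (fun p : G × G => p.1 * p.2 * p.1⁻¹) :=
  (contMDiff_fst.mul contMDiff_snd).mul contMDiff_fst.inv

theorem contMDiff_adjointAction :
    ContMDiff IG 𝓘(ℝ, EG →L[ℝ] EG) ∞ (adjointAction IG : G → EG →L[ℝ] EG) :=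
  have : IsManifold IG ∞ G := ContMDiffMul.toIsManifold
  contMDiff_modelDeriv (f := fun g k : G => g * k * g⁻¹) contMDiff_conj (p := 1) (by simp)

theorem mdifferentiableAt_conj (g k : G) :
    MDifferentiableAt IG IG (fun k : G => g * k * g⁻¹) k :=
  contMDiff_conj.mdifferentiableAt_right (f := fun g k : G => g * k * g⁻¹) g k

theorem mdifferentiableAt_adjointAction (g : G) :
    MDifferentiableAt IG 𝓘(ℝ, EG →L[ℝ] EG) (adjointAction IG : G → EG →L[ℝ] EG) g :=
  contMDiff_adjointAction.mdifferentiableAt (by simp)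

/-- The invariant field is the differential of a left translation, and pulling back inverts the
differential of the inverse chart, which amounts to applying that of the chart. -/
theorem mpullbackWithin_mulInvariantVectorField_extChartAt_symm (v : EG) {z : EG}
    (hz : z ∈ (extChartAt IG (1 : G)).target) :
    mpullbackWithin 𝓘(ℝ, EG) IG (extChartAt IG (1 : G)).symm
        (mulInvariantVectorField (I := IG) (G := G) v) (range IG) z =
      modelDeriv IG 𝓘(ℝ, EG)
        (fun k => extChartAt IG (1 : G) ((extChartAt IG (1 : G)).symm z * k)) 1 v := by
  have : IsManifold IG ∞ G := ContMDiffMul.toIsManifold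
  have : IsManifold IG 1 G := IsManifold.of_le (n := ∞) (by simp)
  have hinv : (mfderivWithin 𝓘(ℝ, EG) IG (extChartAt IG (1 : G)).symm (range IG) z).inverse =
      mfderiv IG 𝓘(ℝ, EG) (extChartAt IG (1 : G)) ((extChartAt IG (1 : G)).symm z) :=
    ContinuousLinearMap.inverse_eq (mfderivWithin_extChartAt_symm_comp_mfderiv_extChartAt hz)
      (mfderiv_extChartAt_comp_mfderivWithin_extChartAt_symm hz)
  have hs : (extChartAt IG (1 : G)).symm z ∈ (chartAt MG (1 : G)).source := by
    rw [← extChartAt_source IG]; exact (extChartAt IG (1 : G)).map_target hz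
  rw [modelDeriv_comp (g := extChartAt IG (1 : G)) (f := fun k => (extChartAt IG (1 : G)).symm z * k)
    (mul_one _) (mdifferentiableAt_extChartAt hs)
    ((contMDiff_mul_left (n := ∞)).mdifferentiableAt (by simp))]
  exact congrArg (fun L : EG →L[ℝ] EG => L (modelDeriv IG IG
    (fun k => (extChartAt IG (1 : G)).symm z * k) 1 v)) hinv

variable [IG.Boundaryless]

/-- The Lie bracket read in the chart at the identity. -/
theorem bracket_eq_modelDeriv_sub (u v : GroupLieAlgebra IG G) :
    ⁅u, v⁆ =
      modelDeriv IG 𝓘(ℝ, EG →L[ℝ] EG) (fun h : G => modelDeriv IG 𝓘(ℝ, EG)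
        (fun k : G => extChartAt IG (1 : G) (h * k)) 1) 1 u v -
      modelDeriv IG 𝓘(ℝ, EG →L[ℝ] EG) (fun h : G => modelDeriv IG 𝓘(ℝ, EG)
        (fun k : G => extChartAt IG (1 : G) (h * k)) 1) 1 v u := by
  have : IsManifold IG ∞ G := ContMDiffMul.toIsManifold
  have : IsManifold IG 1 G := IsManifold.of_le (n := ∞) (by simp)
  set A : G → EG →L[ℝ] EG := fun h : G => modelDeriv IG 𝓘(ℝ, EG)
        (fun k : G => extChartAt IG (1 : G) (h * k)) 1 with hA
  have hs : ContMDiffAt IG 𝓘(ℝ, EG →L[ℝ] EG) ∞ A 1 := by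
    apply contMDiffAt_modelDeriv_of_vector (f := fun h k : G => extChartAt IG (1 : G) (h * k))
    exact ContMDiffAt.comp_of_eq (y := (1 : G)) contMDiffAt_extChartAt
      ((contMDiff_mul IG ∞) (1, 1)) (one_mul 1)
  have hA1 : A 1 = ContinuousLinearMap.id ℝ EG := by
    simp only [hA, one_mul]; exact modelDeriv_extChartAt_self 1
  have hd := hasFDerivAt_modelDeriv (hs.mdifferentiableAt (by simp))
  -- In the chart every invariant field is `A` evaluated at a fixed vector, so the derivative of `A`
  -- determines all brackets.
  have key (w : EG) : mpullbackWithin 𝓘(ℝ, EG) IG (extChartAt IG (1 : G)).symm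
        (mulInvariantVectorField (I := IG) (G := G) w) (range IG)
      =ᶠ[𝓝 (extChartAt IG (1 : G) 1)] fun z => A ((extChartAt IG (1 : G)).symm z) w := by
    filter_upwards [extChartAt_target_mem_nhds (I := IG) (1 : G)] with z hz
    exact mpullbackWithin_mulInvariantVectorField_extChartAt_symm w hz
  have hk (w : EG) : HasFDerivAt (mpullbackWithin 𝓘(ℝ, EG) IG (extChartAt IG (1 : G)).symm
        (mulInvariantVectorField (I := IG) (G := G) w) (range IG) : EG → EG)
      ((modelDeriv IG 𝓘(ℝ, EG →L[ℝ] EG) A 1).flip w) (extChartAt IG (1 : G) 1) := by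
    refine HasFDerivAt.congr_of_eventuallyEq ?_ (key w)
    exact (ContinuousLinearMap.apply ℝ EG w).hasFDerivAt.comp (extChartAt IG (1 : G) 1) hd
  have hv (w : EG) : mpullbackWithin 𝓘(ℝ, EG) IG (extChartAt IG (1 : G)).symm
        (mulInvariantVectorField (I := IG) (G := G) w) (range IG) (extChartAt IG (1 : G) 1) = w := by
    refine (key w).eq_of_nhds.trans ?_
    rw [extChartAt_to_inv, hA1]
    rfl
  rw [GroupLieAlgebra.bracket_def, ← mlieBracketWithin_univ, mlieBracketWithin_apply]
  -- The chart bracket is carried back by the inverse of the chart's derivative, here the identity.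
  have hi : (modelDeriv IG 𝓘(ℝ, EG) (extChartAt IG (1 : G)) 1).inverse =
      ContinuousLinearMap.id ℝ EG := by
    rw [modelDeriv_extChartAt_self, ContinuousLinearMap.inverse_id]
  refine (congrArg (fun L : EG →L[ℝ] EG => L _) hi).trans ?_
  rw [preimage_univ, univ_inter, IG.range_eq_univ]
  rw [IG.range_eq_univ] at hk hv
  have hb (X Y : EG → EG) (z u v : EG) (L K : EG →L[ℝ] EG) (hX : HasFDerivAt X L z)
      (hY : HasFDerivAt Y K z) (hXz : X z = u) (hYz : Y z = v) :
      lieBracketWithin ℝ X Y univ z = K u - L v := by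
    rw [lieBracketWithin_univ, lieBracket, hX.fderiv, hY.fderiv, hXz, hYz]
  exact hb _ _ _ u v _ _ (hk u) (hk v) (hv u) (hv v)

/-- The differential of the adjoint action is the Lie bracket. -/
theorem adjointDeriv_apply (u v : GroupLieAlgebra IG G) : adjointDeriv IG G u v = ⁅u, v⁆ := by
  have : IsManifold IG ∞ G := ContMDiffMul.toIsManifold
  have : IsManifold IG 1 G := IsManifold.of_le (n := ∞) (by simp)
  have hF : ContMDiffAt (IG.prod IG) 𝓘(ℝ, EG) ∞
      (fun p : G × G => extChartAt IG (1 : G) (p.1 * p.2)) (1, 1) :=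
    ContMDiffAt.comp_of_eq (y := (1 : G)) contMDiffAt_extChartAt
      ((contMDiff_mul IG ∞) (1, 1)) (one_mul 1)
  have hF' : ContMDiffAt (IG.prod IG) 𝓘(ℝ, EG) ∞
      (fun p : G × G => extChartAt IG (1 : G) (p.2 * p.1)) (1, 1) :=
    ContMDiffAt.comp_of_eq (f := fun p : G × G => p.2 * p.1) (y := (1 : G)) contMDiffAt_extChartAt
      (contMDiff_snd.mul contMDiff_fst (1, 1)) (one_mul 1)
  -- Writing `A` for the left translation derivative of `bracket_eq_modelDeriv_sub` and `R` for its
  -- right analogue below, this reads `A'(v) u = R'(u) v`.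
  have hsymm := modelDeriv_modelDeriv_symm_of_vector
    (f := fun h k : G => extChartAt IG (1 : G) (h * k)) hF v u
  have hR := contMDiffAt_modelDeriv_of_vector
    (f := fun h k : G => extChartAt IG (1 : G) (k * h)) hF'
  set R : G → EG →L[ℝ] EG := fun h : G => modelDeriv IG 𝓘(ℝ, EG)
        (fun k : G => extChartAt IG (1 : G) (k * h)) 1 with hRdef
  have hR1 : R 1 = ContinuousLinearMap.id ℝ EG := by
    simp only [hRdef, mul_one]; exact modelDeriv_extChartAt_self 1
  have hAd := (contMDiff_adjointAction (IG := IG) (G := G)).mdifferentiableAt (x := 1) (by simp)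
  have hprod := modelDeriv_clm_comp (hR.mdifferentiableAt (by simp)) hAd u v
  -- From `h * k = (h * k * h⁻¹) * h`; `h` must stay in the chart domain. The product rule at `1`
  -- then gives `A'(u) v = R'(u) v + ad(u) v`, and subtracting `A'(v) u` leaves `ad(u) v`.
  have hev : (fun h : G => (R h).comp (adjointAction IG h)) =ᶠ[𝓝 1] fun h : G =>
      modelDeriv IG 𝓘(ℝ, EG) (fun k : G => extChartAt IG (1 : G) (h * k)) 1 := by
    filter_upwards [chart_source_mem_nhds MG (1 : G)] with h hh
    have := modelDeriv_comp (g := fun k : G => extChartAt IG (1 : G) (k * h))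
      (f := fun k : G => h * k * h⁻¹) (x := 1) (y := 1) (IM := IG) (IN := IG) (by simp)
      ((mdifferentiableAt_extChartAt (I := IG) (by simpa using hh)).comp 1
        ((contMDiff_mul_right (n := ∞) (a := h)).mdifferentiableAt (by simp)))
      ((contMDiff_conj (IG := IG)).mdifferentiableAt_right (f := fun g k : G => g * k * g⁻¹) h 1)
    simp only [inv_mul_cancel_right] at this
    exact this.symm
  have hcongr : modelDeriv IG 𝓘(ℝ, EG →L[ℝ] EG)
      (fun h : G => (R h).comp (adjointAction IG h)) 1 = modelDeriv IG 𝓘(ℝ, EG →L[ℝ] EG)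
        (fun h : G => modelDeriv IG 𝓘(ℝ, EG) (fun k : G => extChartAt IG (1 : G) (h * k)) 1) 1 :=
    hev.mfderiv_eq
  rw [bracket_eq_modelDeriv_sub, hsymm, ← hcongr]
  simp only [hprod, hR1, adjointAction_one]
  exact (add_sub_cancel_left _ _).symm

end Adjoint

/-! ### Differentiating homomorphisms and actions -/

section Action

variable {EG MG EH MH : Type*}
  [NormedAddCommGroup EG] [NormedSpace ℝ EG] [TopologicalSpace MG]
  [NormedAddCommGroup EH] [NormedSpace ℝ EH] [TopologicalSpace MH]
  {IG : ModelWithCorners ℝ EG MG} {IH : ModelWithCorners ℝ EH MH}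
  {G H : Type*}
  [TopologicalSpace G] [ChartedSpace MG G] [Group G]
  [TopologicalSpace H] [ChartedSpace MH H] [Group H]

namespace LieGroupAction

variable (Φ : LieGroupAction IG IH G H)

theorem contMDiff_apply (g : G) : ContMDiff IH IH ∞ (fun k => Φ.toHom g k) :=
  Φ.contMDiff_action.comp (contMDiff_const.prodMk contMDiff_id)

theorem mdifferentiableAt_apply (g : G) (k : H) :
    MDifferentiableAt IH IH (fun k => Φ.toHom g k) k :=
  (Φ.contMDiff_apply g).mdifferentiableAt (by simp)

theorem tangentAction_eq (g : G) :
    Φ.tangentAction g = modelDeriv IH IH (fun k : H => Φ.toHom g k) 1 := rfl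

theorem diffActionL_eq :
    Φ.diffActionL = modelDeriv IG 𝓘(ℝ, EH →L[ℝ] EH) Φ.tangentAction (1 : G) := rfl

theorem tangentAction_one : Φ.tangentAction 1 = ContinuousLinearMap.id ℝ EH := by
  simp only [tangentAction_eq, map_one, MulAut.one_apply]
  exact modelDeriv_id 1

theorem tangentAction_mul (g k : G) :
    Φ.tangentAction (g * k) = (Φ.tangentAction g).comp (Φ.tangentAction k) := by
  simp only [tangentAction_eq]
  rw [← modelDeriv_comp (g := fun h => Φ.toHom g h) (by simp) (Φ.mdifferentiableAt_apply g 1)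
    (Φ.mdifferentiableAt_apply k 1)]
  simp

end LieGroupAction

variable [LieGroup IG ∞ G] [LieGroup IH ∞ H]

/-- A smooth homomorphism of Lie groups intertwines the adjoint actions. -/
theorem modelDeriv_comp_adjointAction (f : G →* H) (hf : ContMDiff IG IH ∞ f) (g : G) :
    (modelDeriv IG IH f 1).comp (adjointAction IG g) =
      (adjointAction IH (f g)).comp (modelDeriv IG IH f 1) := by
  have hf1 := hf.mdifferentiableAt (x := 1) (by simp)
  rw [adjointAction, adjointAction, ← modelDeriv_comp (by simp) hf1 (mdifferentiableAt_conj g 1),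
    ← modelDeriv_comp (g := fun k : H => f g * k * (f g)⁻¹) (map_one f)
      (mdifferentiableAt_conj (f g) 1) hf1]
  simp

/-- The derivative of a smooth homomorphism of Lie groups preserves the bracket. -/
theorem modelDeriv_adjointDeriv [IG.Boundaryless] (f : G →* H) (hf : ContMDiff IG IH ∞ f)
    (u v : EG) :
    modelDeriv IG IH f 1 (adjointDeriv IG G u v) =
      adjointDeriv IH H (modelDeriv IG IH f 1 u) (modelDeriv IG IH f 1 v) := by
  have hG := mdifferentiableAt_adjointAction (IG := IG) (1 : G)
  have hH := mdifferentiableAt_adjointAction (IG := IH) (1 : H)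
  have hf1 := hf.mdifferentiableAt (x := 1) (by simp)
  have hc : MDifferentiableAt IG 𝓘(ℝ, EH →L[ℝ] EH) (fun g => adjointAction IH (f g)) 1 :=
    hH.comp_of_eq 1 hf1 (map_one f)
  -- The intertwining relation is already the first derivative of `f (g * k * g⁻¹) = f g * f k * (f
  -- g)⁻¹`; now `g` varies.
  have h := congrArg (fun F => modelDeriv IG 𝓘(ℝ, EG →L[ℝ] EH) F 1 u v)
    (funext (modelDeriv_comp_adjointAction f hf))
  rw [modelDeriv_clm_comp mdifferentiableAt_const hG, modelDeriv_clm_comp hc mdifferentiableAt_const,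
    modelDeriv_const, modelDeriv_comp (map_one f) hH hf1] at h
  simpa [adjointDeriv] using h

namespace LieGroupAction

variable (Φ : LieGroupAction IG IH G H)

theorem contMDiff_tangentAction : ContMDiff IG 𝓘(ℝ, EH →L[ℝ] EH) ∞ Φ.tangentAction :=
  have : IsManifold IG ∞ G := ContMDiffMul.toIsManifold
  have : IsManifold IH ∞ H := ContMDiffMul.toIsManifold
  contMDiff_modelDeriv (f := fun g k => Φ.toHom g k) Φ.contMDiff_action (p := 1) (by simp)

theorem mdifferentiableAt_tangentAction (g : G) :
    MDifferentiableAt IG 𝓘(ℝ, EH →L[ℝ] EH) Φ.tangentAction g :=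
  Φ.contMDiff_tangentAction.mdifferentiableAt (by simp)

variable [IG.Boundaryless]

/-- The differentiated action preserves brackets. -/
theorem diffActionL_adjointDeriv_left (x y : EG) (u : EH) :
    Φ.diffActionL (adjointDeriv IG G x y) u =
      Φ.diffActionL x (Φ.diffActionL y u) - Φ.diffActionL y (Φ.diffActionL x u) := by
  have hT := Φ.mdifferentiableAt_tangentAction 1
  have hAd := mdifferentiableAt_adjointAction (IG := IG) (1 : G)
  -- Derivative in `k` at `1` of T(gkg⁻¹) T(g) = T(g) T(k), where T is `Φ.tangentAction`.
  have h1 (g : G) : (Φ.diffActionL (adjointAction IG g y)).comp (Φ.tangentAction g) =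
      (Φ.tangentAction g).comp (Φ.diffActionL y) := by
    have hfun : (fun k : G => (Φ.tangentAction (g * k * g⁻¹)).comp (Φ.tangentAction g)) =
        fun k : G => (Φ.tangentAction g).comp (Φ.tangentAction k) := by
      funext k
      rw [← Φ.tangentAction_mul, ← Φ.tangentAction_mul, inv_mul_cancel_right]
    have hg := mdifferentiableAt_conj (IG := IG) g 1
    have hg1 : g * 1 * g⁻¹ = 1 := by simp
    have hTg : MDifferentiableAt IG 𝓘(ℝ, EH →L[ℝ] EH)
        (fun k : G => Φ.tangentAction (g * k * g⁻¹)) 1 := hT.comp_of_eq 1 hg hg1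
    ext w
    have h := congrArg (fun F => modelDeriv IG 𝓘(ℝ, EH →L[ℝ] EH) F 1 y w) hfun
    rw [modelDeriv_clm_comp hTg mdifferentiableAt_const,
      modelDeriv_clm_comp mdifferentiableAt_const hT, modelDeriv_const,
      modelDeriv_comp (f := fun k : G => g * k * g⁻¹) hg1 hT hg,
      ← Φ.diffActionL_eq] at h
    simpa [adjointAction] using h
  have hAdy : MDifferentiableAt IG 𝓘(ℝ, EG) (fun g => adjointAction IG g y) (1 : G) :=
    hAd.clm_apply mdifferentiableAt_const
  have hφAd : MDifferentiableAt IG 𝓘(ℝ, EH →L[ℝ] EH)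
      (fun g => Φ.diffActionL (adjointAction IG g y)) (1 : G) :=
    Φ.diffActionL.mdifferentiableAt.comp 1 hAdy
  have hev : modelDeriv IG 𝓘(ℝ, EG) (fun g : G => adjointAction IG g y) 1 x =
      adjointDeriv IG G x y :=
    modelDeriv_clm (ContinuousLinearMap.apply ℝ EG y) hAd x
  -- Derivative in `g` at `1` along `x`: φ([x, y])u + φ(y)φ(x)u = φ(x)φ(y)u.
  have h := congrArg (fun F => modelDeriv IG 𝓘(ℝ, EH →L[ℝ] EH) F 1 x u) (funext h1)
  rw [modelDeriv_clm_comp hφAd hT, modelDeriv_clm_comp hT mdifferentiableAt_const,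
    modelDeriv_const, modelDeriv_clm _ hAdy, hev, Φ.tangentAction_one, adjointAction_one,
    ← Φ.diffActionL_eq] at h
  simp only [zero_apply, map_zero, add_zero] at h
  exact eq_sub_of_add_eq h

variable [IH.Boundaryless]

/-- The differentiated action is by derivations. -/
theorem diffActionL_adjointDeriv (x : EG) (u v : EH) :
    Φ.diffActionL x (adjointDeriv IH H u v) =
      adjointDeriv IH H (Φ.diffActionL x u) v + adjointDeriv IH H u (Φ.diffActionL x v) := by
  set ad : EH →L[ℝ] EH →L[ℝ] EH := adjointDeriv IH H
  have hT := Φ.mdifferentiableAt_tangentAction 1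
  have hTu : MDifferentiableAt IG 𝓘(ℝ, EH) (fun g => Φ.tangentAction g u) 1 :=
    hT.clm_apply mdifferentiableAt_const
  -- Each Φ(g) is a Lie group automorphism, so its differential preserves brackets; differentiating
  -- this in `g` gives the Leibniz rule.
  have hfun : (fun g : G => (Φ.tangentAction g).comp (ad u)) =
      fun g : G => (ad (Φ.tangentAction g u)).comp (Φ.tangentAction g) := by
    funext g
    ext w
    exact modelDeriv_adjointDeriv (Φ.toHom g).toMonoidHom (Φ.contMDiff_apply g) u w
  have h := congrArg (fun F => modelDeriv IG 𝓘(ℝ, EH →L[ℝ] EH) F 1 x v) hfun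
  have hadT : MDifferentiableAt IG 𝓘(ℝ, EH →L[ℝ] EH) (fun g => ad (Φ.tangentAction g u)) 1 :=
    ad.mdifferentiableAt.comp 1 hTu
  have hev : modelDeriv IG 𝓘(ℝ, EH) (fun g => Φ.tangentAction g u) 1 x = Φ.diffActionL x u :=
    modelDeriv_clm (ContinuousLinearMap.apply ℝ EH u) hT x
  rw [modelDeriv_clm_comp hT mdifferentiableAt_const, modelDeriv_clm_comp hadT hT,
    modelDeriv_const, modelDeriv_clm ad hTu, hev, Φ.tangentAction_one, ← Φ.diffActionL_eq] at h
  simpa using h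

/-- The differentiated action as a homomorphism to the Lie algebra of derivations. -/
def diffActionHom [CompleteSpace EG] [CompleteSpace EH] : GroupLieAlgebra IG G →ₗ⁅ℝ⁆
    LieDerivation ℝ (GroupLieAlgebra IH H) (GroupLieAlgebra IH H) where
  toFun x :=
    { toFun := Φ.diffAction x
      map_add' := fun u v => (Φ.diffActionL x).map_add u v
      map_smul' := fun t u => (Φ.diffActionL x).map_smul t u
      leibniz' := fun u v => by
        change Φ.diffAction x ⁅u, v⁆ = ⁅u, Φ.diffAction x v⁆ - ⁅v, Φ.diffAction x u⁆
        rw [← lie_skew v (Φ.diffAction x u), sub_neg_eq_add, ← adjointDeriv_apply,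
          ← adjointDeriv_apply, ← adjointDeriv_apply]
        exact (Φ.diffActionL_adjointDeriv x u v).trans (add_comm _ _) }
  map_add' x y := by
    ext u
    exact congrArg (fun L : EH →L[ℝ] EH => L u) (Φ.diffActionL.map_add x y)
  map_smul' t x := by
    ext u
    exact congrArg (fun L : EH →L[ℝ] EH => L u) (Φ.diffActionL.map_smul t x)
  map_lie' {x y} := by
    ext u
    rw [LieDerivation.commutator_apply]
    change Φ.diffAction ⁅x, y⁆ u = _
    rw [← adjointDeriv_apply]
    exact Φ.diffActionL_adjointDeriv_left x y u

end LieGroupAction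

end Action

/-! ### The descendent group: its bracket and its action on 𝔤 -/

section Descendent

variable {EG MG EH MH : Type*}
  [NormedAddCommGroup EG] [NormedSpace ℝ EG] [TopologicalSpace MG]
  [NormedAddCommGroup EH] [NormedSpace ℝ EH] [TopologicalSpace MH]
  {IG : ModelWithCorners ℝ EG MG} {IH : ModelWithCorners ℝ EH MH}
  {G H : Type*}
  [TopologicalSpace G] [ChartedSpace MG G] [Group G]
  [TopologicalSpace H] [ChartedSpace MH H] [Group H]
  {Φ : LieGroupAction IG IH G H}

namespace RelRotaBaxter

variable (B : RelRotaBaxter Φ)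

/-- A relative Rota-Baxter operator is a homomorphism on the descendent group. -/
def descHom : B.DescGroup →* G where
  toFun := B.toFun
  map_one' := B.map_one
  map_mul' h₁ h₂ := (B.mul_eq h₁ h₂).symm

/-- The derivative of a relative Rota-Baxter operator, on the model spaces. -/
def diffL : EH →L[ℝ] EG := modelDeriv IH IG B.toFun (1 : H)

theorem mdifferentiableAt_toFun (h : H) : MDifferentiableAt IH IG B.toFun h :=
  B.contMDiff_toFun.mdifferentiableAt (by simp)

theorem toFun_dagger (k : H) : B.toFun (B.dagger k) = (B.toFun k)⁻¹ :=
  B.descHom.map_inv k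

theorem toFun_star (a b : H) : B.toFun (B.star a b) = B.toFun a * B.toFun b :=
  (B.mul_eq a b).symm

/-- Inserting `h⁻¹ * h` makes both factors trivial at `k = 1`, so that `modelDeriv_mul` applies. -/
theorem star_conj (h k : H) :
    B.star (B.star h k) (B.dagger h) = (h * Φ.toHom (B.toFun h) k * h⁻¹) *
      (h * Φ.toHom (B.toFun h * B.toFun k * (B.toFun h)⁻¹) h⁻¹) := by
  have e : B.star (B.star h k) (B.dagger h) =
      B.star h k * Φ.toHom (B.toFun (B.star h k)) (B.dagger h) := rfl
  rw [e, B.toFun_star, dagger, ← MulAut.mul_apply, ← _root_.map_mul, star]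
  group

theorem Theta_apply (k : H) (g : G) :
    B.Theta k g = (B.toFun (Φ.toHom g (B.dagger k)))⁻¹ * g * B.toFun (B.dagger k) := rfl

/-- Since 𝓑(k†) = 𝓑(k)⁻¹, a conjugation can be split off; both factors are trivial at `g = 1`. -/
theorem Theta_eq (k : H) (g : G) :
    B.Theta k g = ((B.toFun (Φ.toHom g (B.dagger k)))⁻¹ * B.toFun (B.dagger k)) *
      (B.toFun k * g * (B.toFun k)⁻¹) := by
  rw [B.Theta_apply, B.toFun_dagger]
  group

theorem dagger_star (k l : H) : B.dagger (B.star k l) = B.star (B.dagger l) (B.dagger k) :=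
  mul_inv_rev (G := B.DescGroup) k l

/-- The definition of Θ says g · 𝓑(l†) = 𝓑(Φ(g)l†) · Θ(l)g. Applying Φ to it shows how Φ(g) acts on
the ⋆-product l† ⋆ k†, which is `hs`. -/
theorem Theta_star (k l : H) (g : G) : B.Theta (B.star k l) g = B.Theta k (B.Theta l g) := by
  have hs : Φ.toHom g (B.star (B.dagger l) (B.dagger k)) =
      B.star (Φ.toHom g (B.dagger l)) (Φ.toHom (B.Theta l g) (B.dagger k)) := by
    rw [star, star, _root_.map_mul, ← MulAut.mul_apply, ← _root_.map_mul, ← MulAut.mul_apply,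
      ← _root_.map_mul, B.Theta_apply, ← mul_assoc, mul_inv_cancel_left]
  rw [B.Theta_apply, B.dagger_star, hs, B.toFun_star, B.toFun_star, B.Theta_apply k,
    B.Theta_apply l]
  group

theorem Theta_desc_one (g : G) : B.Theta 1 g = g := by
  rw [Theta]
  simp only [inv_one]
  have h1 : Φ.toHom g (1 : H) = 1 := _root_.map_one _
  change (B.toFun (Φ.toHom g (1 : H)))⁻¹ * g * B.toFun (1 : H) = g
  rw [h1, B.map_one]
  simp

theorem tangentTheta_eq (k : B.DescGroup) :
    B.tangentTheta k = modelDeriv IG IG (B.Theta k) 1 := rfl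

theorem tangentTheta_one : B.tangentTheta 1 = 1 := by
  rw [tangentTheta_eq, funext B.Theta_desc_one]
  exact modelDeriv_id 1

variable [LieGroup IG ∞ G]

/-- The linearized action as a perturbation of the adjoint action. -/
theorem tangentTheta_eq_add (k : H) :
    B.tangentTheta k = modelDeriv IG IG
      (fun g : G => (B.toFun (Φ.toHom g (B.dagger k)))⁻¹ * B.toFun (B.dagger k)) 1 +
        adjointAction IG (B.toFun k) := by
  have h1 : ContMDiff IG IG ∞ (fun g : G => B.toFun (Φ.toHom g (B.dagger k))) :=
    B.contMDiff_toFun.comp (Φ.contMDiff_action.comp (contMDiff_id.prodMk contMDiff_const))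
  have h2 := (h1.inv.mul (contMDiff_const (c := B.toFun (B.dagger k)))).mdifferentiableAt
    (x := 1) (by simp)
  refine (congrArg (fun f : G → G => modelDeriv IG IG f 1) (funext (B.Theta_eq k))).trans ?_
  exact modelDeriv_mul h2 (mdifferentiableAt_conj (IG := IG) (B.toFun k) 1) (by simp) (by simp)

variable [LieGroup IH ∞ H]

theorem contMDiff_Theta :
    ContMDiff (IH.prod IG) IG ∞ (fun q : B.DescGroup × G => B.Theta q.1 q.2) := by
  have hinv : ContMDiff (IH.prod IG) IH ∞ (fun q : B.DescGroup × G => q.1⁻¹) :=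
    contMDiff_fst.inv
  have h1 : ContMDiff (IH.prod IG) IH ∞
      (fun q : B.DescGroup × G => Φ.toHom q.2 (q.1⁻¹ : B.DescGroup)) :=
    Φ.contMDiff_action.comp (contMDiff_snd.prodMk hinv)
  exact ((B.contMDiff_toFun.comp h1).inv.mul contMDiff_snd).mul (B.contMDiff_toFun.comp hinv)

theorem contMDiff_tangentTheta : ContMDiff IH 𝓘(ℝ, EG →L[ℝ] EG) ∞ B.tangentTheta :=
  have : IsManifold IG ∞ G := ContMDiffMul.toIsManifold
  have : IsManifold IH ∞ B.DescGroup := ContMDiffMul.toIsManifold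
  contMDiff_modelDeriv B.contMDiff_Theta B.Theta_one

theorem tangentTheta_mul (k l : B.DescGroup) :
    B.tangentTheta (k * l) = B.tangentTheta k * B.tangentTheta l := by
  rw [tangentTheta_eq,
    show B.Theta (k * l) = fun g => B.Theta k (B.Theta l g) from funext (B.Theta_star k l)]
  exact modelDeriv_comp (B.Theta_one l) (B.contMDiff_Theta.mdifferentiableAt_right k 1)
    (B.contMDiff_Theta.mdifferentiableAt_right l 1)

/-- The adjoint action of the descendent group. -/
theorem adjointAction_desc (h : H) :
    adjointAction IH (G := B.DescGroup) h =
      (adjointAction IH h).comp (Φ.tangentAction (B.toFun h)) +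
        (modelDeriv IG IH (fun g : G => h * Φ.toHom g h⁻¹) 1).comp
          ((adjointAction IG (B.toFun h)).comp B.diffL) := by
  have hΦ : ContMDiff IG IH ∞ (fun g : G => h * Φ.toHom g h⁻¹) :=
    contMDiff_const.mul (Φ.contMDiff_action.comp (contMDiff_id.prodMk contMDiff_const))
  have hΦ1 := hΦ.mdifferentiableAt (x := 1) (by simp)
  have hc := mdifferentiableAt_conj (IG := IG) (B.toFun h) 1
  have hB := B.mdifferentiableAt_toFun 1
  have hcB : MDifferentiableAt IH IG (fun k : H => B.toFun h * B.toFun k * (B.toFun h)⁻¹) 1 :=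
    hc.comp_of_eq 1 hB B.map_one
  have hH := mdifferentiableAt_conj (IG := IH) h 1
  have ha := Φ.mdifferentiableAt_apply (B.toFun h) 1
  have e : adjointAction IH (G := B.DescGroup) h =
      modelDeriv IH IH (fun k : H => (h * Φ.toHom (B.toFun h) k * h⁻¹) *
        (h * Φ.toHom (B.toFun h * B.toFun k * (B.toFun h)⁻¹) h⁻¹)) 1 :=
    congrArg (fun f : H → H => modelDeriv IH IH f 1) (funext (B.star_conj h))
  rw [e, modelDeriv_mul (f := fun k : H => h * Φ.toHom (B.toFun h) k * h⁻¹)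
    (g := fun k : H => h * Φ.toHom (B.toFun h * B.toFun k * (B.toFun h)⁻¹) h⁻¹)
    (hH.comp_of_eq 1 ha (_root_.map_one _))
    (hΦ1.comp_of_eq 1 hcB (by simp [B.map_one])) (by simp) (by simp [B.map_one]),
    modelDeriv_comp (g := fun k : H => h * k * h⁻¹) (_root_.map_one _) hH ha,
    modelDeriv_comp (g := fun g : G => h * Φ.toHom g h⁻¹) (y := 1) (by simp [B.map_one]) hΦ1 hcB,
    modelDeriv_comp (g := fun g : G => B.toFun h * g * (B.toFun h)⁻¹) B.map_one hc hB]
  rfl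

variable [IG.Boundaryless] [IH.Boundaryless]

/-- With the order exchanged, the derivative in `h` at `1` is id - Φ(g)_*, and the derivative of
that in `g` is -φ. -/
theorem modelDeriv_modelDeriv_twist (u : EH) (x : EG) :
    modelDeriv IH 𝓘(ℝ, EG →L[ℝ] EH)
      (fun h : H => modelDeriv IG IH (fun g : G => h * Φ.toHom g h⁻¹) 1) 1 u x =
        - Φ.diffActionL x u := by
  have : IsManifold IG ∞ G := ContMDiffMul.toIsManifold
  have : IsManifold IH ∞ H := ContMDiffMul.toIsManifold
  have hF : ContMDiff (IH.prod IG) IH ∞ (fun q : H × G => q.1 * Φ.toHom q.2 q.1⁻¹) :=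
    contMDiff_fst.mul (Φ.contMDiff_action.comp (contMDiff_snd.prodMk contMDiff_fst.inv))
  rw [modelDeriv_modelDeriv_symm (f := fun (h : H) (g : G) => h * Φ.toHom g h⁻¹) hF (p := 1)
    (by simp) (by simp)]
  have hinv : MDifferentiableAt IH IH (fun h : H => h⁻¹) 1 :=
    (contMDiff_inv IH ∞).mdifferentiableAt (by simp)
  have e (g : G) : modelDeriv IH IH (fun h : H => h * Φ.toHom g h⁻¹) 1 =
      ContinuousLinearMap.id ℝ EH - Φ.tangentAction g := by
    have ha := Φ.mdifferentiableAt_apply g 1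
    rw [modelDeriv_mul (f := fun h : H => h) (g := fun h : H => Φ.toHom g h⁻¹)
      mdifferentiableAt_id (ha.comp_of_eq 1 hinv inv_one) rfl (by simp),
      modelDeriv_comp (g := fun h : H => Φ.toHom g h) inv_one ha hinv, modelDeriv_id,
      modelDeriv_inv (f := fun h : H => h) mdifferentiableAt_id rfl, modelDeriv_id, ← Φ.tangentAction_eq]
    ext v
    simp [sub_eq_add_neg]
  simp_rw [e]
  rw [modelDeriv_sub mdifferentiableAt_const (Φ.mdifferentiableAt_tangentAction 1),
    modelDeriv_const, ← Φ.diffActionL_eq]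
  simp

/-- With the order exchanged, the derivative in `h` at `1` is B - B ∘ Φ(g)_*, measuring how far 𝓑 is
from being Φ(g)-invariant. -/
theorem modelDeriv_modelDeriv_defect (u : EH) (x : EG) :
    modelDeriv IH 𝓘(ℝ, EG →L[ℝ] EG)
      (fun h : H => modelDeriv IG IG
        (fun g : G => (B.toFun (Φ.toHom g h))⁻¹ * B.toFun h) 1) 1 u x =
        - B.diffL (Φ.diffActionL x u) := by
  have : IsManifold IG ∞ G := ContMDiffMul.toIsManifold
  have : IsManifold IH ∞ H := ContMDiffMul.toIsManifold
  have hF : ContMDiff (IH.prod IG) IG ∞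
      (fun q : H × G => (B.toFun (Φ.toHom q.2 q.1))⁻¹ * B.toFun q.1) :=
    (B.contMDiff_toFun.comp (Φ.contMDiff_action.comp (contMDiff_snd.prodMk contMDiff_fst))).inv.mul
      (B.contMDiff_toFun.comp contMDiff_fst)
  rw [modelDeriv_modelDeriv_symm (f := fun (h : H) (g : G) => (B.toFun (Φ.toHom g h))⁻¹ * B.toFun h)
    hF (p := 1) (by simp) (by simp [B.map_one])]
  have hB := B.mdifferentiableAt_toFun 1
  have e (g : G) : modelDeriv IH IG (fun h : H => (B.toFun (Φ.toHom g h))⁻¹ * B.toFun h) 1 =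
      B.diffL - B.diffL.comp (Φ.tangentAction g) := by
    have ha := Φ.mdifferentiableAt_apply g 1
    have hBa : MDifferentiableAt IH IG (fun h : H => B.toFun (Φ.toHom g h)) 1 :=
      hB.comp_of_eq 1 ha (_root_.map_one _)
    have hBai : MDifferentiableAt IH IG (fun h : H => (B.toFun (Φ.toHom g h))⁻¹) 1 :=
      ((contMDiff_inv IG ∞).mdifferentiableAt (by simp)).comp 1 hBa
    rw [modelDeriv_mul hBai hB (by simp [B.map_one]) B.map_one,
      modelDeriv_inv hBa (by simp [B.map_one]),
      modelDeriv_comp (g := B.toFun) (_root_.map_one _) hB ha, ← Φ.tangentAction_eq]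
    exact neg_add_eq_sub _ _
  have hT := Φ.mdifferentiableAt_tangentAction 1
  simp_rw [e]
  rw [modelDeriv_sub mdifferentiableAt_const (mdifferentiableAt_const.clm_comp hT),
    modelDeriv_const, zero_sub]
  have h := modelDeriv_clm_comp (mdifferentiableAt_const (c := B.diffL)) hT x u
  rw [modelDeriv_const, ← Φ.diffActionL_eq] at h
  simp [h]

/-- The bracket of the descendent Lie group. -/
theorem adjointDeriv_desc (u v : EH) :
    adjointDeriv IH B.DescGroup u v =
      Φ.diffActionL (B.diffL u) v - Φ.diffActionL (B.diffL v) u + adjointDeriv IH H u v := by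
  have : IsManifold IG ∞ G := ContMDiffMul.toIsManifold
  have : IsManifold IH ∞ H := ContMDiffMul.toIsManifold
  have e : adjointDeriv IH B.DescGroup u v = modelDeriv IH 𝓘(ℝ, EH →L[ℝ] EH)
      (fun h : H => adjointAction IH (G := B.DescGroup) h) 1 u v := rfl
  have hAdG := mdifferentiableAt_adjointAction (IG := IG) (1 : G)
  have hAdH := mdifferentiableAt_adjointAction (IG := IH) (1 : H)
  have hT := Φ.mdifferentiableAt_tangentAction 1
  have hB := B.mdifferentiableAt_toFun 1
  have hTB : MDifferentiableAt IH 𝓘(ℝ, EH →L[ℝ] EH) (fun h : H => Φ.tangentAction (B.toFun h)) 1 :=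
    hT.comp_of_eq 1 hB B.map_one
  have hAdB : MDifferentiableAt IH 𝓘(ℝ, EG →L[ℝ] EG)
      (fun h : H => adjointAction IG (B.toFun h)) 1 := hAdG.comp_of_eq 1 hB B.map_one
  have hAdBB : MDifferentiableAt IH 𝓘(ℝ, EH →L[ℝ] EG)
      (fun h : H => (adjointAction IG (B.toFun h)).comp B.diffL) 1 :=
    hAdB.clm_comp mdifferentiableAt_const
  have hF : ContMDiff (IH.prod IG) IH ∞ (fun q : H × G => q.1 * Φ.toHom q.2 q.1⁻¹) :=
    contMDiff_fst.mul (Φ.contMDiff_action.comp (contMDiff_snd.prodMk contMDiff_fst.inv))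
  have hC : MDifferentiableAt IH 𝓘(ℝ, EG →L[ℝ] EH)
      (fun h : H => modelDeriv IG IH (fun g : G => h * Φ.toHom g h⁻¹) 1) 1 :=
    (contMDiff_modelDeriv (f := fun (h : H) (g : G) => h * Φ.toHom g h⁻¹) hF (p := 1)
      (by simp)).mdifferentiableAt (by simp)
  -- The twist operator vanishes at the unit, so in the product rule the derivative of its cofactor
  -- drops out.
  have hC1 : modelDeriv IG IH (fun g : G => (1 : H) * Φ.toHom g (1 : H)⁻¹) 1 = 0 := by
    simp only [inv_one, _root_.map_one, mul_one]
    exact modelDeriv_const _ _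
  rw [e]
  simp_rw [B.adjointAction_desc]
  rw [modelDeriv_add (hAdH.clm_comp hTB) (hC.clm_comp hAdBB), add_apply,
    add_apply, modelDeriv_clm_comp hAdH hTB, modelDeriv_clm_comp hC hAdBB,
    modelDeriv_modelDeriv_twist, modelDeriv_comp B.map_one hT hB, hC1, B.map_one,
    Φ.tangentAction_one, adjointAction_one, adjointAction_one, ← Φ.diffActionL_eq]
  change adjointDeriv IH H u v + Φ.diffActionL (B.diffL u) v +
    (- Φ.diffActionL (B.diffL v) u + 0) = _
  abel

/-- The right side is B of the ⋆-bracket, and 𝓑 is a homomorphism on (H, ⋆). -/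
theorem diffL_adjointDeriv (u v : EH) :
    adjointDeriv IG G (B.diffL u) (B.diffL v) =
      B.diffL (Φ.diffActionL (B.diffL u) v - Φ.diffActionL (B.diffL v) u +
        adjointDeriv IH H u v) := by
  rw [← B.adjointDeriv_desc]
  have hB : ContMDiff IH IG ∞ B.descHom := B.contMDiff_toFun
  exact (modelDeriv_adjointDeriv B.descHom hB u v).symm

theorem diffThetaL_apply (u : EH) (x : EG) :
    B.diffThetaL u x = B.diffL (Φ.diffActionL x u) + adjointDeriv IG G (B.diffL u) x := by
  have : IsManifold IG ∞ G := ContMDiffMul.toIsManifold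
  have : IsManifold IH ∞ H := ContMDiffMul.toIsManifold
  have e : B.diffThetaL u x = modelDeriv IH 𝓘(ℝ, EG →L[ℝ] EG)
      (fun h : H => B.tangentTheta h) (1 : H) u x := rfl
  have hB := B.mdifferentiableAt_toFun 1
  have hAdG := mdifferentiableAt_adjointAction (IG := IG) (1 : G)
  have hAdB : MDifferentiableAt IH 𝓘(ℝ, EG →L[ℝ] EG)
      (fun h : H => adjointAction IG (B.toFun h)) 1 := hAdG.comp_of_eq 1 hB B.map_one
  have hF : ContMDiff (IH.prod IG) IG ∞
      (fun q : H × G => (B.toFun (Φ.toHom q.2 q.1))⁻¹ * B.toFun q.1) :=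
    (B.contMDiff_toFun.comp (Φ.contMDiff_action.comp (contMDiff_snd.prodMk contMDiff_fst))).inv.mul
      (B.contMDiff_toFun.comp contMDiff_fst)
  have hE : MDifferentiableAt IH 𝓘(ℝ, EG →L[ℝ] EG) (fun h : H => modelDeriv IG IG
      (fun g : G => (B.toFun (Φ.toHom g h))⁻¹ * B.toFun h) 1) 1 :=
    (contMDiff_modelDeriv (f := fun (h : H) (g : G) => (B.toFun (Φ.toHom g h))⁻¹ * B.toFun h)
      hF (p := 1) (by simp)).mdifferentiableAt (by simp)
  have hd1 : B.dagger 1 = 1 := inv_one (G := B.DescGroup)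
  have hd : MDifferentiableAt IH IH B.dagger (1 : H) :=
    (contMDiff_inv IH ∞ (G := B.DescGroup)).mdifferentiableAt (x := 1) (by simp)
  -- The inverse of (H, ⋆) has differential -1 at the unit, which cancels the sign in
  -- `modelDeriv_modelDeriv_defect`.
  have hdd : modelDeriv IH IH B.dagger (1 : H) = - ContinuousLinearMap.id ℝ EH :=
    (modelDeriv_inv (G := B.DescGroup) (IG := IH) (IN := IH) (f := fun k : B.DescGroup => k) (b := 1)
      mdifferentiableAt_id rfl).trans (congrArg Neg.neg (modelDeriv_id _))
  have hEd : MDifferentiableAt IH 𝓘(ℝ, EG →L[ℝ] EG) (fun h : H => modelDeriv IG IG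
      (fun g : G => (B.toFun (Φ.toHom g (B.dagger h)))⁻¹ * B.toFun (B.dagger h)) 1) 1 :=
    hE.comp_of_eq 1 hd hd1
  rw [e]
  simp_rw [B.tangentTheta_eq_add]
  rw [modelDeriv_add hEd hAdB, modelDeriv_comp B.map_one hAdG hB,
    modelDeriv_comp (g := fun h : H => modelDeriv IG IG
      (fun g : G => (B.toFun (Φ.toHom g h))⁻¹ * B.toFun h) 1) hd1 hE hd, hdd]
  change modelDeriv IH 𝓘(ℝ, EG →L[ℝ] EG) _ 1 (-u) x + adjointDeriv IG G (B.diffL u) x = _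
  rw [B.modelDeriv_modelDeriv_defect, map_neg, map_neg, neg_neg]

end RelRotaBaxter

end Descendent

end

theorem mainTheorem7 {EG MG EH MH : Type*}
    [NormedAddCommGroup EG] [NormedSpace ℝ EG] [CompleteSpace EG] [TopologicalSpace MG]
    [NormedAddCommGroup EH] [NormedSpace ℝ EH] [CompleteSpace EH] [TopologicalSpace MH]
    (IG : ModelWithCorners ℝ EG MG) [IG.Boundaryless]
    (IH : ModelWithCorners ℝ EH MH) [IH.Boundaryless]
    (G H : Type*)
    [TopologicalSpace G] [ChartedSpace MG G] [Group G] [LieGroup IG ∞ G]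
    [TopologicalSpace H] [ChartedSpace MH H] [Group H] [LieGroup IH ∞ H]
    (Φ : LieGroupAction IG IH G H) (B : RelRotaBaxter Φ) :
    -- the differentiated action and operator, with the algebraic structure they carry
    ∃ (φ : GroupLieAlgebra IG G →ₗ⁅ℝ⁆
        LieDerivation ℝ (GroupLieAlgebra IH H) (GroupLieAlgebra IH H))
      (b : LieRelRotaBaxter φ),
      (∀ x u, φ x u = Φ.diffAction x u) ∧ (∀ u, b.toLin u = B.diff u) ∧
      -- the Lie algebra of the descendent Lie group is the descendent Lie algebra
      (∃ e : GroupLieAlgebra IH B.DescGroup ≃ₗ⁅ℝ⁆ b.Descendent,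
        ∀ u : GroupLieAlgebra IH H, e (B.tangentId u) = b.toDescendent u) ∧
      (∀ u v : GroupLieAlgebra IH H, ⁅B.tangentId u, B.tangentId v⁆ =
        B.tangentId (Φ.diffAction (B.diff u) v - Φ.diffAction (B.diff v) u + ⁅u, v⁆)) ∧
      -- `Θ` is a smooth linear action of the descendent Lie group on `𝔤`
      ContMDiff IH 𝓘(ℝ, EG →L[ℝ] EG) ∞ B.tangentTheta ∧
      B.tangentTheta 1 = 1 ∧
      (∀ k l : B.DescGroup, B.tangentTheta (k * l) = B.tangentTheta k * B.tangentTheta l) ∧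
      -- its differential is the representation `θ` of the descendent Lie algebra
      (∀ (u : GroupLieAlgebra IH H) (x : GroupLieAlgebra IG G),
        B.diffTheta (B.tangentId u) x = b.theta (b.toDescendent u) x) ∧
      (∀ (u : GroupLieAlgebra IH H) (x : GroupLieAlgebra IG G),
        B.diffTheta (B.tangentId u) x = B.diff (Φ.diffAction x u) + ⁅B.diff u, x⁆) := by
  let b : LieRelRotaBaxter Φ.diffActionHom :=
    { toLin := (B.diffL : EH →ₗ[ℝ] EG)
      bracket_eq := fun u v => by
        rw [← adjointDeriv_apply, ← adjointDeriv_apply]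
        exact B.diffL_adjointDeriv u v }
  have hbr (u v : GroupLieAlgebra IH H) : ⁅B.tangentId u, B.tangentId v⁆ =
      B.tangentId (Φ.diffAction (B.diff u) v - Φ.diffAction (B.diff v) u + ⁅u, v⁆) := by
    rw [← adjointDeriv_apply, ← adjointDeriv_apply]
    exact B.adjointDeriv_desc u v
  have hθ (u : GroupLieAlgebra IH H) (x : GroupLieAlgebra IG G) :
      B.diffTheta (B.tangentId u) x = B.diff (Φ.diffAction x u) + ⁅B.diff u, x⁆ := by
    rw [← adjointDeriv_apply]
    exact B.diffThetaL_apply u x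
  -- `b.theta` unfolds to the explicit formula, so `hθ` proves both of the last two claims.
  refine ⟨Φ.diffActionHom, b, fun _ _ => rfl, fun _ => rfl,
    ⟨{ B.tangentId.symm.trans b.toDescendent with
        map_lie' := fun {u v} => hbr (B.tangentId.symm u) (B.tangentId.symm v) },
      fun _ => rfl⟩, hbr, B.contMDiff_tangentTheta, B.tangentTheta_one, B.tangentTheta_mul,
    hθ, hθ⟩
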